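/- Define the polynomials $F_s(r)$ by $F_0(r)=F_1(r)=1$ and $F_s(r)=(1+r+2r^2)F_{s-1}(r)+r^3F_{s-2}(r)$ for $s\geq 2$, and let $[q^m]F_s(q)$ denote the coefficient of $q^m$ in $F_s(q)$. Then for every $s\geq 2$ the following hold. 1. (OEIS A134465: $1,6,16,32,55,86,\dots$) $[q^3]F_s(q)=a_{s-1}$, where $(a_n)_{n\ge 1}$ is the binomial transform of $(1,5,5,1,0,0,0,\dots)$, that is, $a_n=\binom{n-1}{0}+5\binom{n-1}{1}+5\binom{n-1}{2}+\binom{n-1}{3}$. 2. (OEIS A098156: $1,2,5,13,32,76,\dots$) $[q^{2s-2}]F_s(q)=b_{s-1}$, where $(b_n)_{n\ge 0}$ is the binomial transform $b_n=\sum_{k=0}^n\binom nk c_k$ of the sequence $(c_k)_{k\ge 0}=(1,1,2,3,3,5,4,7,\dots)$ that interleaves $n+1$ and $2n+1$, that is, $c_{2n}=n+1$ and $c_{2n+1}=2n+1$. 3. (OEIS A116914: $1,1,5,16,58,211,\dots$ for $n\ge 2$) $[q^{s-1}]F_s(q)$ is the total number of occurrences of four consecutive steps $UUDD$ in all hill-free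 Dyck paths of semilength $s+1$. Here a Dyck path has steps $U=(1,1)$ and $D=(1,-1)$, and it is hill-free if it has no peak at level $1$. 4. (OEIS A072547: $1,0,2,6,22,80,\dots$) $[q^s]F_s(q)=T_{s,s}$, where $(T_{i,j})_{i,j\ge 0}$ is the array with $T_{i,0}=T_{0,i}=1$ for even $i$, $T_{i,0}=T_{0,i}=0$ for odd $i$, and $T_{i,j}=T_{i-1,j}+T_{i,j-1}$ for $i,j\ge 1$. 5. (OEIS A002054: $1,5,21,84,\dots$) $[q^{s+1}]F_s(q)=\binom{2n+1}{n-1}$ with $n=s-1$, that is, $[q^{s+1}]F_s(q)=\binom{2s-1}{s-2}$. 6. (OEIS A127531: $0,0,0,2,13,64,285,\dots$ for $n\ge 0$) $[q^{s+2}]F_s(q)$ is the total number of jumps in all binary trees with $s$ edges. Here every node of a binary tree has at most one left child and at most one right child, and a jump is a transition, in the preorder traversal, from a node to a next node that is strictly closer to the root. -/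

import Mathlib

open Polynomial

/-- The polynomials `F_s`: `F_0 = F_1 = 1` and `F_s = (1 + r + 2r²) F_{s-1} + r³ F_{s-2}` for
`s ≥ 2`. -/
noncomputable def F : ℕ → ℤ[X]
  | 0 => 1
  | 1 => 1
  | s + 2 => (1 + X + 2 * X ^ 2) * F (s + 1) + X ^ 3 * F s

namespace OEIS

/-- The finitely supported sequence `1, 5, 5, 1, 0, 0, 0, …`. -/
def oneFiveFiveOne : ℕ → ℕ
  | 0 => 1
  | 1 => 5
  | 2 => 5
  | 3 => 1
  | _ + 4 => 0

/-- The sequence `1, 6, 16, 32, 55, 86, …` (`n ≥ 1`): the binomial transform of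
`1, 5, 5, 1, 0, 0, 0, …`, whose first term has index `n = 1`. -/
def A134465 (n : ℕ) : ℕ :=
  ∑ k ∈ Finset.range n, (n - 1).choose k * oneFiveFiveOne k

/-- The interleaving `1, 1, 2, 3, 3, 5, 4, 7, …` of the sequences `n + 1` and `2n + 1`
(`n = 0, 1, 2, …`). -/
def interleaved (k : ℕ) : ℕ :=
  if Even k then k / 2 + 1 else 2 * (k / 2) + 1

/-- The sequence `1, 2, 5, 13, 32, 76, …` (`n ≥ 0`): interleave `n + 1` and `2n + 1` and take
the binomial transform. -/
def A098156 (n : ℕ) : ℕ :=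
  ∑ k ∈ Finset.range (n + 1), n.choose k * interleaved k

/-- The number of occurrences of four consecutive steps `UUDD` in a lattice path. -/
def countUUDD (l : List DyckStep) : ℕ :=
  l.tails.countP fun t => [DyckStep.U, DyckStep.U, DyckStep.D, DyckStep.D].isPrefixOf t

/-- A lattice path is hill-free if it has no peak at level `1`, i.e. no two consecutive steps
`UD` starting at level `0`. -/
def HillFree (l : List DyckStep) : Prop :=
  ∀ i < l.length, ¬ ([DyckStep.U, DyckStep.D] <+: l.drop i ∧
    (l.take i).count DyckStep.U = (l.take i).count DyckStep.D)

instance : DecidablePred HillFree := fun l => by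
  unfold HillFree; infer_instance

/-- The number of `UUDD`s in all hill-free Dyck paths of semilength `n`
(`1, 1, 5, 16, 58, 211, …` for `n ≥ 2`). -/
def A116914 (n : ℕ) : ℕ :=
  ∑ p : {p : DyckWord // p.semilength = n},
    if HillFree p.1.toList then countUUDD p.1.toList else 0

/-- The infinite array whose first row and first column are filled alternately with `1`s and
`0`s (starting with `1`) and whose other entries are the sum of the entry above and the entry
to the left. -/
def alternatingArray : ℕ → ℕ → ℕ
  | 0, j => if Even j then 1 else 0
  | i + 1, 0 => if Even (i + 1) then 1 else 0
  | i + 1, j + 1 => alternatingArray i (j + 1) + alternatingArray (i + 1) j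

/-- The main diagonal `1, 0, 2, 6, 22, 80, …` (`n ≥ 1`) of `alternatingArray`, whose first term
has index `n = 1`. -/
def A072547 (n : ℕ) : ℕ :=
  alternatingArray (n - 1) (n - 1)

/-- The binomial coefficients `C(2n+1, n-1)`, i.e. `1, 5, 21, 84, …` (`n ≥ 1`). -/
def A002054 (n : ℕ) : ℕ :=
  (2 * n + 1).choose (n - 1)

/-- The levels of the nodes of a binary tree, listed in preorder, when the root has level `d`
(levels increase away from the root). -/
def preorderLevels (d : ℕ) : BinaryTree Unit → List ℕ
  | .nil => []
  | .node _ l r => d :: (preorderLevels (d + 1) l ++ preorderLevels (d + 1) r)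

/-- The number of jumps of a binary tree: the transitions, in the preorder traversal, from a node
to a next node that is strictly closer to the root. -/
def jumps (t : BinaryTree Unit) : ℕ :=
  let L := preorderLevels 0 t
  (L.zip L.tail).countP fun p => decide (p.2 < p.1)

/-- The number of jumps in all binary trees with `n` edges, i.e. with `n + 1` nodes
(`0, 0, 0, 2, 13, 64, 285, …` for `n ≥ 0`). -/
def A127531 (n : ℕ) : ℕ :=
  ∑ t ∈ BinaryTree.treesOfNumNodesEq (n + 1), jumps t

end OEIS

namespace OEIS

/-! Claims 3–6 concern diagonals of the coefficient array. For a fixed integer `k` put `S_k = ∑_s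
[q^{s+k}] F_s · u^s`. The recurrence of `F` becomes `S_k = u S_{k+1} + u S_k + u(2+u) S_{k-1}`, with
corrections only at `k = 0, 1` coming from `F_0 = F_1 = 1`. Away from these two values it is solved
by geometric sequences, one upward and one downward, whose ratios are power series roots of a
quadratic. This gives the closed forms of `shiftS` in terms of the Catalan series `C`, the central
binomial series `B` and the Fine series. `shiftS_rec` verifies the recurrence and
`intCoeff_F_eq_coeff_shiftS` transfers it to `F`.

The cases `k = -1, 0, 1, 2` are then matched with the combinatorial sequences: binomials and the
alternating array through Pascal's rule (`eq_coeff_of_array_rec`), `UUDD`s and jumps through the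
root decomposition of binary trees (`treeS_eq`, `pairS_mul`).

Claims 1 and 2 concern a fixed exponent and a fixed distance from the degree. There the recurrence
of `F` can be solved explicitly and compared with the binomial transforms. -/

/-- The generating function of the Catalan numbers over `ℚ`. -/
noncomputable def catS : PowerSeries ℚ := PowerSeries.mk fun n => (catalan n : ℚ)

local notation "u" => (PowerSeries.X : PowerSeries ℚ)

/-! ### Algebraic relations among the Catalan, central binomial and Fine series. -/

theorem catS_eq : catS = 1 + u * catS ^ 2 := by
  have h := congrArg (PowerSeries.map (Nat.castRingHom ℚ))
    PowerSeries.catalanSeries_sq_mul_X_add_one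
  have h2 : PowerSeries.map (Nat.castRingHom ℚ) PowerSeries.catalanSeries = catS := by
    ext n; simp [catS]
  simp only [map_add, map_mul, map_pow, map_one, PowerSeries.map_X, h2] at h
  linear_combination -h

/-- The generating function of the central binomial coefficients. -/
noncomputable def binS : PowerSeries ℚ := (1 - 2 * u * catS)⁻¹

/-- The generating function of the Fine numbers, which count hill-free Dyck paths. -/
noncomputable def fineS : PowerSeries ℚ := (1 - u * (catS - 1))⁻¹

/-- The generating function of the main diagonal of `alternatingArray`. -/
noncomputable def diagS : PowerSeries ℚ := ((1 - u) * binS + 1) * (2 + u)⁻¹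

theorem binS_mul : binS * (1 - 2 * u * catS) = 1 :=
  PowerSeries.inv_mul_cancel _ (by simp)

theorem fineS_mul : fineS * (1 - u * (catS - 1)) = 1 :=
  PowerSeries.inv_mul_cancel _ (by simp)

theorem inv_two_add_mul : (2 + u)⁻¹ * (2 + u) = 1 :=
  PowerSeries.inv_mul_cancel _ (by simp [map_ofNat])

theorem two_add_ne_zero : (2 + u) ≠ 0 := right_ne_zero_of_mul_eq_one inv_two_add_mul

theorem diagS_mul : (2 + u) * diagS = (1 - u) * binS + 1 := by
  rw [diagS]; linear_combination ((1 - u) * binS + 1) * inv_two_add_mul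

/-- The Catalan equation factors `2 + u` as `(1 + C)(1 - u(C - 1))`, and the second factor is
inverse to `fineS`. -/
theorem two_add_mul_fineS : (2 + u) * fineS = 1 + catS := by
  have h := fineS_mul
  have hc := catS_eq
  have : (2 + u) * fineS = fineS * ((1 + catS) * (1 - u * (catS - 1))) := by
    linear_combination -fineS * hc
  rw [this]; linear_combination (1 + catS) * h

theorem constantCoeff_catS : PowerSeries.constantCoeff catS = 1 := by
  rw [catS_eq]; simp

theorem constantCoeff_binS : PowerSeries.constantCoeff binS = 1 := by
  simp [binS]

/-! ### The diagonal series and their recurrence. -/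

/-- The generating function of the coefficients `[q^{s+k}] F_s`, for a fixed integer `k`. -/
noncomputable def shiftS : ℤ → PowerSeries ℚ
  | .ofNat 0 => diagS
  | .ofNat (k + 1) => u ^ 2 * binS * catS ^ 3 * (u * catS * (catS + 1)) ^ k
  | .negSucc k => diagS * (u * catS * fineS) ^ (k + 1)

theorem shiftS_zero : shiftS 0 = diagS := rfl
theorem shiftS_succ (k : ℕ) : shiftS (k + 1) =
    u ^ 2 * binS * catS ^ 3 * (u * catS * (catS + 1)) ^ k := rfl
theorem shiftS_neg (k : ℕ) : shiftS (-k) = diagS * (u * catS * fineS) ^ k := by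
  cases k with
  | zero => simp [shiftS_zero]
  | succ k => rfl

/-- The characteristic equation of the recurrence in `k`: its power series root is the ratio of
`shiftS` for `k ≥ 1`. -/
theorem quadratic_upper : u * catS * (catS + 1) =
    u * (u * catS * (catS + 1)) ^ 2 + u * (u * catS * (catS + 1)) + u * (2 + u) := by
  have := catS_eq
  grind

/-- The characteristic equation for decreasing `k`. Since `(2 + u)` times this ratio is the upper
ratio, it follows from `quadratic_upper`. -/
theorem quadratic_lower : u * catS * fineS =
    u * (2 + u) * (u * catS * fineS) ^ 2 + u * (u * catS * fineS) + u := by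
  have := two_add_mul_fineS
  have h : (2 + u) * (u * catS * fineS) = u * catS * (catS + 1) := by
    linear_combination u * catS * this
  apply mul_left_cancel₀ two_add_ne_zero
  have h2 := quadratic_upper
  rw [← h] at h2
  linear_combination h2

theorem shiftS_rec_one : shiftS 1 =
    u * shiftS 2 + u * shiftS 1 + u * (2 + u) * shiftS 0 - 2 * u := by
  have h1 : shiftS 1 = _ := shiftS_succ 0
  have h2 : shiftS 2 = _ := shiftS_succ 1
  rw [h1, h2, shiftS_zero]
  have := diagS_mul
  have := catS_eq
  have := binS_mul
  grind

theorem shiftS_rec_zero : shiftS 0 =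
    u * shiftS 1 + u * shiftS 0 + u * (2 + u) * shiftS (-1) + (1 - u) := by
  have h1 : shiftS 1 = _ := shiftS_succ 0
  have h2 : shiftS (-1) = _ := shiftS_neg 1
  rw [h1, h2, shiftS_zero]
  apply mul_left_cancel₀ two_add_ne_zero
  have := catS_eq
  have := binS_mul
  have := diagS_mul
  have := two_add_mul_fineS
  grind

/-- The corrections encode the initial values: `1` at `k = 0` is `F_0`, while `-u` and `-2u` remove
the terms `r` and `2r²` that the recurrence would wrongly give to `F_1`. -/
theorem shiftS_rec (k : ℤ) : shiftS k =
    u * shiftS (k + 1) + u * shiftS k + u * (2 + u) * shiftS (k - 1)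
      + (if k = 0 then 1 - u else 0) - (if k = 1 then 2 * u else 0) := by
  obtain h | rfl | rfl | h : k < 0 ∨ k = 0 ∨ k = 1 ∨ 1 < k := by omega
  · obtain ⟨n, rfl⟩ : ∃ n : ℕ, k = -((n + 1 : ℕ) : ℤ) := ⟨(-k - 1).toNat, by omega⟩
    rw [if_neg (by omega), if_neg (by omega),
      show -((n + 1 : ℕ) : ℤ) + 1 = -(n : ℤ) by push_cast; ring,
      show -((n + 1 : ℕ) : ℤ) - 1 = -((n + 2 : ℕ) : ℤ) by push_cast; ring,
      shiftS_neg, shiftS_neg, shiftS_neg]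
    linear_combination diagS * (u * catS * fineS) ^ n * quadratic_lower
  · simpa using shiftS_rec_zero
  · simpa using shiftS_rec_one
  · obtain ⟨n, rfl⟩ : ∃ n : ℕ, k = ((n + 1 : ℕ) : ℤ) + 1 := ⟨(k - 2).toNat, by omega⟩
    rw [if_neg (by omega), if_neg (by omega),
      show ((n + 1 : ℕ) : ℤ) + 1 + 1 = ((n + 2 : ℕ) : ℤ) + 1 by push_cast; ring,
      show ((n + 1 : ℕ) : ℤ) + 1 - 1 = (n : ℤ) + 1 by push_cast; ring,
      shiftS_succ, shiftS_succ, shiftS_succ]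
    linear_combination u ^ 2 * binS * catS ^ 3 * (u * catS * (catS + 1)) ^ n * quadratic_upper

theorem coeff_zero_shiftS (k : ℤ) : PowerSeries.coeff 0 (shiftS k) = if k = 0 then 1 else 0 := by
  rw [shiftS_rec k]
  split_ifs <;> simp_all

theorem coeff_two_mul (n : ℕ) (f : PowerSeries ℚ) :
    PowerSeries.coeff n (2 * f) = 2 * PowerSeries.coeff n f := by
  rw [two_mul, map_add, two_mul]

theorem coeff_one_shiftS (k : ℤ) : PowerSeries.coeff 1 (shiftS k) = if k = -1 then 1 else 0 := by
  have h2 (f : PowerSeries ℚ) : u * (2 + u) * f = u * (2 * f + u * f) := by ring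
  have h3 : PowerSeries.coeff 1 (1 - u) = (-1 : ℚ) := by
    simp [PowerSeries.coeff_one, PowerSeries.coeff_X]
  have h4 : PowerSeries.coeff 1 (2 * u) = (2 : ℚ) := by
    rw [coeff_two_mul]; simp [PowerSeries.coeff_X]
  have h5 (f : PowerSeries ℚ) : PowerSeries.coeff 1 (u * f) = PowerSeries.coeff 0 f :=
    PowerSeries.coeff_succ_X_mul 0 f
  rw [shiftS_rec k, h2, map_sub, map_add, map_add, map_add, apply_ite (PowerSeries.coeff 1),
    apply_ite (PowerSeries.coeff 1), h3, h4]
  simp only [h5, map_add, coeff_two_mul, coeff_zero_shiftS,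
    PowerSeries.coeff_zero_X_mul, map_zero]
  split_ifs <;> first | omega | norm_num

theorem coeff_add_two_shiftS (s : ℕ) (k : ℤ) : PowerSeries.coeff (s + 2) (shiftS k) =
    PowerSeries.coeff (s + 1) (shiftS (k + 1)) + PowerSeries.coeff (s + 1) (shiftS k)
      + 2 * PowerSeries.coeff (s + 1) (shiftS (k - 1)) + PowerSeries.coeff s (shiftS (k - 1)) := by
  have h2 (f : PowerSeries ℚ) : u * (2 + u) * f = u * (2 * f + u * f) := by ring
  have h3 : PowerSeries.coeff (s + 2) (1 - u) = (0 : ℚ) := by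
    simp [PowerSeries.coeff_one, PowerSeries.coeff_X]
  have h4 : PowerSeries.coeff (s + 2) (2 * u) = (0 : ℚ) := by
    rw [coeff_two_mul]; simp [PowerSeries.coeff_X]
  conv_lhs => rw [shiftS_rec k, h2]
  rw [map_sub, map_add, map_add, map_add, apply_ite (PowerSeries.coeff (s + 2)),
    apply_ite (PowerSeries.coeff (s + 2)), h3, h4, show s + 2 = (s + 1) + 1 from rfl]
  simp only [PowerSeries.coeff_succ_X_mul, map_add, coeff_two_mul, map_zero, ite_self]
  ring

/-! ### Coefficients of `F` along diagonals. -/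

/-- The coefficient of a polynomial at an integer exponent. -/
noncomputable def intCoeff (p : ℤ[X]) (i : ℤ) : ℤ := if 0 ≤ i then p.coeff i.toNat else 0

theorem intCoeff_natCast (p : ℤ[X]) (n : ℕ) : intCoeff p n = p.coeff n := by simp [intCoeff]

theorem intCoeff_add (p q : ℤ[X]) (i : ℤ) : intCoeff (p + q) i = intCoeff p i + intCoeff q i := by
  unfold intCoeff; split_ifs <;> simp

theorem intCoeff_X_mul (p : ℤ[X]) (i : ℤ) : intCoeff (X * p) i = intCoeff p (i - 1) := by
  unfold intCoeff
  obtain h | rfl | h : i < 0 ∨ i = 0 ∨ 0 < i := by omega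
  · rw [if_neg (by omega), if_neg (by omega)]
  · simp
  · obtain ⟨n, rfl⟩ : ∃ n : ℕ, i = (n : ℤ) + 1 := ⟨(i - 1).toNat, by omega⟩
    rw [if_pos (by omega), if_pos (by omega), show ((n : ℤ) + 1).toNat = n + 1 by omega,
      show ((n : ℤ) + 1 - 1).toNat = n by omega, coeff_X_mul]

theorem intCoeff_one (i : ℤ) : intCoeff 1 i = if i = 0 then 1 else 0 := by
  unfold intCoeff
  split_ifs with h1 h2 h2
  · simp [h2]
  · rw [coeff_one, if_neg (by omega)]
  · omega
  · rfl

theorem intCoeff_F_add_two (s : ℕ) (i : ℤ) : intCoeff (F (s + 2)) i =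
    intCoeff (F (s + 1)) i + intCoeff (F (s + 1)) (i - 1) + 2 * intCoeff (F (s + 1)) (i - 2)
      + intCoeff (F s) (i - 3) := by
  have : F (s + 2) = F (s + 1) + X * F (s + 1) + X * (X * F (s + 1)) + X * (X * F (s + 1))
      + X * (X * (X * F s)) := by
    rw [F]; ring
  rw [this]
  simp only [intCoeff_add, intCoeff_X_mul]
  rw [show i - 1 - 1 = i - 2 by ring, show i - 2 - 1 = i - 3 by ring]
  ring

/-- The recurrence mixes neighbouring diagonals, so the induction on `s` treats all `k` at once;
integer exponents are needed because `s + k` may be negative. -/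
theorem intCoeff_F_eq_coeff_shiftS (s : ℕ) (k : ℤ) :
    (intCoeff (F s) (s + k) : ℚ) = PowerSeries.coeff s (shiftS k) := by
  induction s using Nat.twoStepInduction generalizing k with
  | zero => simp [F, intCoeff_one, coeff_zero_shiftS]
  | one =>
    rw [coeff_one_shiftS, F, intCoeff_one]
    simp only [Nat.cast_one, Int.cast_ite, Int.cast_one, Int.cast_zero]
    congr 1
    simp; omega
  | more s ih0 ih1 =>
    rw [coeff_add_two_shiftS, ← ih0, ← ih1, ← ih1, ← ih1, intCoeff_F_add_two]
    push_cast
    ring_nf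

/-! ### Symmetric arrays with Pascal's rule. -/

/-- Here `T n k` stands for the entry `(n, n + k)` of a symmetric array with Pascal's rule; symmetry
turns the rule on the main diagonal into `hT0`. The constants `e k` affect only the coefficients at
`n = 0`, which `h0` supplies. -/
theorem eq_coeff_of_array_rec (T : ℕ → ℕ → ℚ) (R : ℕ → PowerSeries ℚ) (e : ℕ → ℚ)
    (h0 : ∀ k, T 0 k = PowerSeries.coeff 0 (R k))
    (hT0 : ∀ n, T (n + 1) 0 = 2 * T n 1)
    (hT : ∀ n k, T (n + 1) (k + 1) = T n (k + 2) + T (n + 1) k)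
    (hR0 : R 0 = PowerSeries.C (e 0) + u * (2 * R 1))
    (hR : ∀ k, R (k + 1) = PowerSeries.C (e (k + 1)) + u * R (k + 2) + R k) (n k : ℕ) :
    T n k = PowerSeries.coeff n (R k) := by
  induction n generalizing k with
  | zero => exact h0 k
  | succ n ih =>
    induction k with
    | zero =>
      rw [hT0, hR0, map_add, PowerSeries.coeff_succ_X_mul, coeff_two_mul, ih,
        PowerSeries.coeff_C, if_neg n.succ_ne_zero, zero_add]
    | succ k ihk =>
      rw [hT, hR, map_add, map_add, PowerSeries.coeff_succ_X_mul, ih, ihk,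
        PowerSeries.coeff_C, if_neg n.succ_ne_zero, zero_add]

theorem choose_two_mul_add (n k : ℕ) :
    ((2 * n + k).choose n : ℚ) = PowerSeries.coeff n (binS * catS ^ k) := by
  refine eq_coeff_of_array_rec (fun n k => ((2 * n + k).choose n : ℚ)) (fun k => binS * catS ^ k)
    (fun k => if k = 0 then 1 else 0) ?_ ?_ ?_ ?_ ?_ n k
  · intro k
    simp [constantCoeff_binS, constantCoeff_catS]
  · intro n
    have h := Nat.choose_succ_succ (2 * n + 1) n
    have h2 : (2 * n + 1).choose (n + 1) = (2 * n + 1).choose n :=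
      Nat.choose_symm_half n
    rw [Nat.succ_eq_add_one, Nat.succ_eq_add_one, h2] at h
    show (((2 * (n + 1) + 0).choose (n + 1) : ℕ) : ℚ) = 2 * ((2 * n + 1).choose n : ℕ)
    rw [show 2 * (n + 1) + 0 = 2 * n + 1 + 1 by ring, h]
    push_cast; ring
  · intro n k
    have h := Nat.choose_succ_succ (2 * n + k + 2) n
    show (((2 * (n + 1) + (k + 1)).choose (n + 1) : ℕ) : ℚ) =
      ((2 * n + (k + 2)).choose n : ℕ) + ((2 * (n + 1) + k).choose (n + 1) : ℕ)
    rw [show 2 * (n + 1) + (k + 1) = 2 * n + k + 2 + 1 by ring,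
      show 2 * n + (k + 2) = 2 * n + k + 2 by ring,
      show 2 * (n + 1) + k = 2 * n + k + 2 by ring]
    exact_mod_cast h
  · simp only [if_true, map_one]
    linear_combination binS_mul
  · intro k
    simp only [Nat.succ_ne_zero, if_false, map_zero]
    linear_combination binS * catS ^ k * catS_eq

theorem alternatingArray_comm (i j : ℕ) : alternatingArray i j = alternatingArray j i := by
  induction i generalizing j with
  | zero => cases j <;> simp [alternatingArray]
  | succ i ih =>
    induction j with
    | zero => simp [alternatingArray]
    | succ j ihj => rw [alternatingArray, alternatingArray, ih, ihj, add_comm]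

theorem alternatingArray_eq_coeff (n : ℕ) :
    (alternatingArray n n : ℚ) = PowerSeries.coeff n diagS := by
  have key := eq_coeff_of_array_rec (fun n k => (alternatingArray n (n + k) : ℚ))
    -- `B C^k` solves the homogeneous relation because `C = 1 + u C²`; the summand `(-1)^k / (2 +
    -- u)` is a particular solution for the alternating border.
    (fun k => ((1 - u) * binS * catS ^ k + (-1) ^ k) * (2 + u)⁻¹) (fun k => (-1) ^ k)
    ?_ ?_ ?_ ?_ ?_ n 0
  · simpa [diagS] using key
  · intro k
    rcases Nat.even_or_odd k with h | h
    · simp [alternatingArray, h, constantCoeff_binS, constantCoeff_catS, map_ofNat]; norm_num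
    · simp [alternatingArray, h, Nat.not_even_iff_odd.mpr h, constantCoeff_binS,
        constantCoeff_catS, map_ofNat]
  · intro n
    show ((alternatingArray (n + 1) (n + 1) : ℕ) : ℚ) = 2 * (alternatingArray n (n + 1) : ℕ)
    rw [alternatingArray, alternatingArray_comm (n + 1) n]
    push_cast; ring
  · intro n k
    show ((alternatingArray (n + 1) (n + 1 + k + 1) : ℕ) : ℚ) =
      (alternatingArray n (n + (k + 2)) : ℕ) + (alternatingArray (n + 1) (n + 1 + k) : ℕ)
    rw [alternatingArray, show n + 1 + k + 1 = n + (k + 2) by ring]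
    push_cast; ring
  · simp only [pow_zero, map_one]
    apply mul_left_cancel₀ two_add_ne_zero
    have := inv_two_add_mul
    have := binS_mul
    have := catS_eq
    grind
  · intro k
    simp only [map_pow, map_neg, map_one]
    linear_combination (1 - u) * binS * catS ^ k * (2 + u)⁻¹ * catS_eq
      - (-1) ^ k * inv_two_add_mul

/-! ### Generating functions of statistics on binary trees. -/

open BinaryTree Finset

/-- The generating function, by number of nodes, of a statistic on binary trees. -/
noncomputable def treeS (f : BinaryTree Unit → ℚ) : PowerSeries ℚ :=
  PowerSeries.mk fun n => ∑ t ∈ treesOfNumNodesEq n, f t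

/-- The generating function, by total number of nodes, of a statistic on pairs of binary trees. -/
noncomputable def pairS (e : BinaryTree Unit → BinaryTree Unit → ℚ) : PowerSeries ℚ :=
  PowerSeries.mk fun n => ∑ ij ∈ antidiagonal n,
    ∑ l ∈ treesOfNumNodesEq ij.1, ∑ r ∈ treesOfNumNodesEq ij.2, e l r

theorem sum_treesOfNumNodesEq_succ (n : ℕ) (f : BinaryTree Unit → ℚ) :
    ∑ t ∈ treesOfNumNodesEq (n + 1), f t = ∑ ij ∈ antidiagonal n,
      ∑ l ∈ treesOfNumNodesEq ij.1, ∑ r ∈ treesOfNumNodesEq ij.2, f (node () l r) := by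
  rw [treesOfNumNodesEq_succ, sum_biUnion]
  · refine sum_congr rfl fun ij _ => ?_
    rw [sum_map, sum_product]
    rfl
  · simp_rw [Set.PairwiseDisjoint, Set.Pairwise, disjoint_left]
    aesop

theorem treeS_eq (f : BinaryTree Unit → ℚ) :
    treeS f = PowerSeries.C (f nil) + u * pairS fun l r => f (node () l r) := by
  ext n
  cases n with
  | zero => simp [treeS]
  | succ n =>
    rw [map_add, PowerSeries.coeff_succ_X_mul, PowerSeries.coeff_C, if_neg n.succ_ne_zero,
      zero_add, treeS, pairS, PowerSeries.coeff_mk, PowerSeries.coeff_mk,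
      sum_treesOfNumNodesEq_succ]

theorem pairS_add (e e' : BinaryTree Unit → BinaryTree Unit → ℚ) :
    pairS (fun l r => e l r + e' l r) = pairS e + pairS e' := by
  ext n; simp [pairS, sum_add_distrib]

theorem pairS_mul (g h : BinaryTree Unit → ℚ) :
    pairS (fun l r => g l * h r) = treeS g * treeS h := by
  ext n
  simp only [pairS, treeS, PowerSeries.coeff_mk, PowerSeries.coeff_mul]
  exact sum_congr rfl fun ij _ => (sum_mul_sum _ _ _ _).symm

theorem treeS_add (f g : BinaryTree Unit → ℚ) :
    treeS (fun t => f t + g t) = treeS f + treeS g := by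
  ext n; simp [treeS, sum_add_distrib]

theorem treeS_sub (f g : BinaryTree Unit → ℚ) :
    treeS (fun t => f t - g t) = treeS f - treeS g := by
  ext n; simp [treeS, sum_sub_distrib]

theorem treeS_one : treeS (fun _ => 1) = catS := by
  ext n; simp [treeS, catS, treesOfNumNodesEq_card_eq_catalan]

theorem treeS_indicator (t : BinaryTree Unit) :
    treeS (fun t' => if t' = t then 1 else 0) = u ^ t.numNodes := by
  ext n
  simp [treeS, PowerSeries.coeff_X_pow, eq_comm]

theorem treeS_ne_nil : treeS (fun t => if t = nil then 0 else 1) = catS - 1 := by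
  have : (fun t : BinaryTree Unit => if t = nil then (0 : ℚ) else 1) =
      fun t => 1 - if t = nil then 1 else 0 := by
    funext t; split_ifs <;> simp
  rw [this, treeS_sub, treeS_one, treeS_indicator]; simp [numNodes]

/-! ### Jumps -/

theorem preorderLevels_map_succ (d : ℕ) (t : BinaryTree Unit) :
    preorderLevels (d + 1) t = (preorderLevels d t).map (· + 1) := by
  induction t generalizing d with
  | nil => rfl
  | node a l r ihl ihr => simp [preorderLevels, ihl (d + 1), ihr (d + 1)]

theorem le_of_mem_preorderLevels {d x : ℕ} {t : BinaryTree Unit}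
    (hx : x ∈ preorderLevels d t) : d ≤ x := by
  induction t generalizing d with
  | nil => simp [preorderLevels] at hx
  | node a l r ihl ihr =>
    simp only [preorderLevels, List.mem_cons, List.mem_append] at hx
    rcases hx with rfl | hx | hx
    · exact le_rfl
    · exact (Nat.le_succ d).trans (ihl hx)
    · exact (Nat.le_succ d).trans (ihr hx)

/-- The number of descents of a list. -/
def descents : List ℕ → ℕ
  | [] => 0
  | [_] => 0
  | a :: b :: L => (if b < a then 1 else 0) + descents (b :: L)

theorem descents_eq_countP (L : List ℕ) :
    (L.zip L.tail).countP (fun p => decide (p.2 < p.1)) = descents L := by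
  induction L with
  | nil => rfl
  | cons a L ih =>
    cases L with
    | nil => rfl
    | cons b L =>
      rw [descents, ← ih]
      simp [List.countP_cons, add_comm]

theorem descents_map_succ (L : List ℕ) : descents (L.map (· + 1)) = descents L := by
  induction L with
  | nil => rfl
  | cons a L ih =>
    cases L with
    | nil => rfl
    | cons b L =>
      simp only [List.map_cons, descents] at ih ⊢
      rw [ih]; simp

theorem descents_cons_of_le (a : ℕ) (L : List ℕ) (h : ∀ x ∈ L, a ≤ x) :
    descents (a :: L) = descents L := by
  cases L with
  | nil => rfl
  | cons b L => rw [descents, if_neg (not_lt.mpr (h b (by simp))), zero_add]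

theorem descents_append_cons (L : List ℕ) (b : ℕ) (M : List ℕ) :
    descents (L ++ b :: M) =
      descents L + descents (b :: M) + if ∃ x ∈ L.getLast?, b < x then 1 else 0 := by
  induction L with
  | nil => simp [descents]
  | cons a L ih =>
    cases L with
    | nil => simp [descents]; ring
    | cons c L =>
      simp only [List.cons_append, descents] at ih ⊢
      rw [ih]; simp [add_assoc]

theorem jumps_eq_descents (d : ℕ) (t : BinaryTree Unit) :
    jumps t = descents (preorderLevels d t) := by
  induction d with
  | zero => exact descents_eq_countP _
  | succ d ih => rw [preorderLevels_map_succ, descents_map_succ, ih]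

/-- With at least two nodes, the last node in preorder is not the root, hence lies strictly below
it. -/
theorem exists_getLast?_preorderLevels (d : ℕ) (t : BinaryTree Unit) :
    (∃ x ∈ (preorderLevels d t).getLast?, d < x) ↔ t ≠ nil ∧ t ≠ node () nil nil := by
  cases t with
  | nil => simp [preorderLevels]
  | node a l r =>
    by_cases h : preorderLevels (d + 1) l ++ preorderLevels (d + 1) r = []
    · have hl : l = nil := by cases l <;> simp_all [preorderLevels]
      have hr : r = nil := by cases r <;> simp_all [preorderLevels]
      subst hl hr
      simp [preorderLevels]
    · have hmem := List.getLast_mem h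
      have hlt : d < (preorderLevels (d + 1) l ++ preorderLevels (d + 1) r).getLast h := by
        rcases List.mem_append.mp hmem with h' | h' <;> exact le_of_mem_preorderLevels h'
      have hne : node a l r ≠ node () nil nil := by
        rintro ⟨⟩; exact h rfl
      refine iff_of_true ⟨_, ?_, hlt⟩ ⟨by simp, hne⟩
      rw [preorderLevels, List.getLast?_cons, List.getLast?_eq_getLast_of_ne_nil h]
      simp

/-- The only new possible jump is from the last node of `l` to the root of `r`, which is level with
the root of `l`. -/
theorem jumps_node (l r : BinaryTree Unit) :
    jumps (node () l r) = jumps l + jumps r +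
      if (l ≠ nil ∧ l ≠ node () nil nil) ∧ r ≠ nil then 1 else 0 := by
  rw [jumps_eq_descents 0, preorderLevels, descents_cons_of_le _ _ (by simp),
    jumps_eq_descents 1 l, jumps_eq_descents 1 r]
  cases r with
  | nil => simp [preorderLevels, descents]
  | node a l' r' =>
    rw [preorderLevels, zero_add, descents_append_cons]
    simp only [exists_getLast?_preorderLevels]
    simp

theorem treeS_jumps : treeS (fun t => jumps t) = u * (catS - 1 - u) * (catS - 1) * binS := by
  have h : treeS (fun t => jumps t) = u * (treeS (fun t => jumps t) * catS +
      catS * treeS (fun t => jumps t) + (catS - 1 - u) * (catS - 1)) := by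
    have h1 : treeS (fun t => (if t = nil then 0 else 1) - if t = node () nil nil then 1 else 0) =
        catS - 1 - u := by
      rw [treeS_sub, treeS_ne_nil, treeS_indicator]; simp [numNodes]
    conv_lhs => rw [treeS_eq]
    rw [← h1, ← treeS_ne_nil, ← treeS_one, ← pairS_mul, ← pairS_mul, ← pairS_mul, ← pairS_add,
      ← pairS_add]
    have h0 : jumps nil = 0 := rfl
    simp only [h0, Nat.cast_zero, map_zero, zero_add]
    congr 2
    funext l r
    rw [jumps_node]
    by_cases hl : l = nil
    · subst hl; simp
    · by_cases hl' : l = node () nil nil <;> by_cases hr : r = nil <;> simp [hl, hl', hr]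
  have hb := binS_mul
  linear_combination (-treeS (fun t => jumps t)) * hb + binS * h

/-! ### Occurrences of `UUDD` in hill-free Dyck paths -/

theorem countUUDD_cons (a : DyckStep) (l : List DyckStep) : countUUDD (a :: l) =
    (if [DyckStep.U, DyckStep.U, DyckStep.D, DyckStep.D] <+: a :: l then 1 else 0)
      + countUUDD l := by
  simp [countUUDD, List.countP_cons, add_comm]

/-- No occurrence straddles the junction: the part inside `l` would be a suffix `U`, `UU` or `UUD`,
each with more `U`s than `D`s. -/
theorem countUUDD_append (l m : List DyckStep)
    (h : ∀ b, b <:+ l → b.count DyckStep.U ≤ b.count DyckStep.D) :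
    countUUDD (l ++ m) = countUUDD l + countUUDD m := by
  induction l with
  | nil => simp [countUUDD]
  | cons a l ih =>
    have hl := h _ List.suffix_rfl
    have hpre : [DyckStep.U, DyckStep.U, DyckStep.D, DyckStep.D] <+: a :: (l ++ m) ↔
        [DyckStep.U, DyckStep.U, DyckStep.D, DyckStep.D] <+: a :: l := by
      rcases l with _ | ⟨b, _ | ⟨c, _ | ⟨d, l⟩⟩⟩
      · cases a <;> simp at hl ⊢
      · cases a <;> cases b <;> simp at hl ⊢
      · cases a <;> cases b <;> cases c <;> simp at hl ⊢
      · simp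
    rw [List.cons_append, countUUDD_cons, countUUDD_cons,
      ih fun b hb => h b (hb.trans (List.suffix_cons a l)), add_assoc]
    simp only [hpre]

theorem count_U_le_count_D_of_suffix (p : DyckWord) {b : List DyckStep} (hb : b <:+ p.toList) :
    b.count DyckStep.U ≤ b.count DyckStep.D := by
  obtain ⟨a, ha⟩ := hb
  have h1 := p.count_U_eq_count_D
  have h2 := p.count_D_le_count_U a.length
  rw [← ha, List.take_left] at h2
  rw [← ha, List.count_append, List.count_append] at h1
  omega

theorem count_D_le_count_U_of_append (p : DyckWord) {a b : List DyckStep}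
    (h : p.toList = a ++ b) : a.count DyckStep.D ≤ a.count DyckStep.U := by
  have h2 := p.count_D_le_count_U a.length
  rwa [h, List.take_left] at h2

theorem toList_nest_add (p q : DyckWord) :
    (p.nest + q).toList = DyckStep.U :: (p.toList ++ DyckStep.D :: q.toList) := by
  show ([DyckStep.U] ++ p.toList ++ [DyckStep.D]) ++ q.toList = _
  simp

/-- If `p` continued after `UD`, its third step would have to be `D`, taking it below level `0`. -/
theorem uudd_prefix_iff (p : DyckWord) (m : List DyckStep) :
    [DyckStep.U, DyckStep.U, DyckStep.D, DyckStep.D] <+: DyckStep.U :: (p.toList ++ DyckStep.D :: m)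
      ↔ p.toList = [DyckStep.U, DyckStep.D] := by
  have h := p.count_U_eq_count_D
  have h3 := p.count_D_le_count_U 3
  rcases hp : p.toList with _ | ⟨a, _ | ⟨b, _ | ⟨c, l⟩⟩⟩
  · simp
  · rw [hp] at h; cases a <;> simp at h
  · cases a <;> cases b <;> simp
  · rw [hp] at h3; cases a <;> cases b <;> cases c <;> simp at h3 ⊢

theorem countUUDD_nest_add (p q : DyckWord) : countUUDD (p.nest + q).toList =
    countUUDD p.toList + countUUDD q.toList +
      if p.toList = [DyckStep.U, DyckStep.D] then 1 else 0 := by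
  rw [toList_nest_add, countUUDD_cons,
    countUUDD_append _ _ fun b hb => count_U_le_count_D_of_suffix p hb, countUUDD_cons]
  have hD : ¬ [DyckStep.U, DyckStep.U, DyckStep.D, DyckStep.D] <+: DyckStep.D :: q.toList := by
    simp
  simp only [uudd_prefix_iff, if_neg hD]
  ring

theorem hillFree_iff (l : List DyckStep) : HillFree l ↔
    ∀ a b, l = a ++ b → [DyckStep.U, DyckStep.D] <+: b →
      a.count DyckStep.U ≠ a.count DyckStep.D := by
  constructor
  · rintro h a b rfl hb hc
    have hlen := hb.length_le
    refine h a.length (by simp at hlen ⊢; omega) ⟨?_, ?_⟩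
    · rwa [List.drop_left]
    · rwa [List.take_left]
  · rintro h i - ⟨h1, h2⟩
    exact h _ _ (List.take_append_drop i l).symm h1 h2

/-- Nesting raises every peak of `p` above level `1`, so the first component is a hill only when `p`
is empty. -/
theorem hillFree_nest_add (p q : DyckWord) :
    HillFree (p.nest + q).toList ↔ p.toList ≠ [] ∧ HillFree q.toList := by
  rw [toList_nest_add, hillFree_iff, hillFree_iff]
  constructor
  · intro h
    refine ⟨fun hp => ?_, ?_⟩
    · exact h [] _ rfl (by simp [hp]) rfl
    · intro a b hab hb hc
      refine h (DyckStep.U :: (p.toList ++ DyckStep.D :: a)) b (by simp [hab]) hb ?_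
      have := p.count_U_eq_count_D
      simp [List.count_append]
      omega
  · rintro ⟨hp, hq⟩ a b hab hb hc
    rcases a with _ | ⟨x, a⟩
    · rw [List.nil_append] at hab
      rw [← hab] at hb
      rcases hp' : p.toList with _ | ⟨y, l⟩
      · exact hp hp'
      · have h1 := p.count_D_le_count_U 1
        rw [hp'] at hb h1
        cases y <;> simp at hb h1
    · rw [List.cons_append, List.cons.injEq] at hab
      obtain ⟨rfl, hab⟩ := hab
      rw [List.append_eq_append_iff] at hab
      rcases hab with ⟨c, hc1, hc2⟩ | ⟨c, hc1, hc2⟩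
      · rcases c with _ | ⟨y, c⟩
        · have := p.count_U_eq_count_D
          simp [hc1] at hc
          omega
        · rw [List.cons_append, List.cons.injEq] at hc2
          obtain ⟨rfl, hc2⟩ := hc2
          refine hq c b hc2 hb ?_
          have := p.count_U_eq_count_D
          simp [hc1, List.count_append] at hc
          omega
      · have := count_D_le_count_U_of_append p hc1
        simp at hc
        omega

/-- The number of `UUDD`s in the Dyck path encoded by a binary tree. -/
def treeUUDD (t : BinaryTree Unit) : ℕ := countUUDD (DyckWord.ofTree t).toList

/-- The indicator of the binary trees that encode a hill-free Dyck path. -/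
def treeHillFree (t : BinaryTree Unit) : ℕ := if HillFree (DyckWord.ofTree t).toList then 1 else 0

theorem toList_ofTree_eq_nil_iff (t : BinaryTree Unit) :
    (DyckWord.ofTree t).toList = [] ↔ t = nil := by
  cases t with
  | nil => simp [DyckWord.ofTree]; rfl
  | node a l r => simp [DyckWord.ofTree, toList_nest_add]

theorem toList_ofTree_eq_UD_iff (t : BinaryTree Unit) :
    (DyckWord.ofTree t).toList = [DyckStep.U, DyckStep.D] ↔ t = node () nil nil := by
  have h : (DyckWord.ofTree (node () nil nil)).toList = [DyckStep.U, DyckStep.D] := rfl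
  rw [← h, ← DyckWord.ext_iff]
  exact DyckWord.equivTree.symm.apply_eq_iff_eq (x := t) (y := node () nil nil)

theorem treeUUDD_node (l r : BinaryTree Unit) : treeUUDD (node () l r) =
    treeUUDD l + treeUUDD r + if l = node () nil nil then 1 else 0 := by
  simp only [treeUUDD, DyckWord.ofTree, countUUDD_nest_add, toList_ofTree_eq_UD_iff]

theorem treeHillFree_node (l r : BinaryTree Unit) : treeHillFree (node () l r) =
    (if l = nil then 0 else 1) * treeHillFree r := by
  simp only [treeHillFree, DyckWord.ofTree, hillFree_nest_add, ne_eq, toList_ofTree_eq_nil_iff]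
  by_cases hl : l = nil <;> simp [hl]

theorem A116914_eq (n : ℕ) :
    (A116914 n : ℚ) = PowerSeries.coeff n (treeS fun t => treeHillFree t * treeUUDD t) := by
  have h : A116914 n = ∑ t ∈ treesOfNumNodesEq n, treeHillFree t * treeUUDD t := by
    rw [A116914, ← Finset.sum_coe_sort (treesOfNumNodesEq n)]
    refine Fintype.sum_equiv (DyckWord.equivTreesOfNumNodesEq n) _ _ fun p => ?_
    simp [treeHillFree, treeUUDD, DyckWord.ofTree_toTree]
  rw [h, treeS, PowerSeries.coeff_mk]
  push_cast
  rfl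

theorem treeS_treeUUDD : treeS (fun t => treeUUDD t) = u ^ 2 * catS * binS := by
  have h : treeS (fun t => treeUUDD t) = u * (treeS (fun t => treeUUDD t) * catS +
      catS * treeS (fun t => treeUUDD t) + u * catS) := by
    have h1 : treeS (fun t => if t = node () nil nil then 1 else 0) = u := by
      rw [treeS_indicator]; simp [numNodes]
    conv_lhs => rw [treeS_eq]
    conv_rhs => enter [2, 2, 1]; rw [← h1]
    rw [← treeS_one, ← pairS_mul, ← pairS_mul, ← pairS_mul, ← pairS_add, ← pairS_add]
    have h0 : treeUUDD nil = 0 := rfl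
    simp [h0, treeUUDD_node]
  have hb := binS_mul
  linear_combination (-treeS (fun t => treeUUDD t)) * hb + binS * h

theorem treeS_treeHillFree : treeS (fun t => treeHillFree t) = fineS := by
  have h : treeS (fun t => treeHillFree t) =
      1 + u * ((catS - 1) * treeS (fun t => treeHillFree t)) := by
    conv_lhs => rw [treeS_eq]
    rw [← treeS_ne_nil, ← pairS_mul]
    have h0 : treeHillFree nil = 1 := rfl
    simp [h0, treeHillFree_node]
  have hb := fineS_mul
  linear_combination (-treeS (fun t => treeHillFree t)) * hb + fineS * h

theorem treeS_treeHillFree_mul_treeUUDD :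
    treeS (fun t => treeHillFree t * treeUUDD t) = u * (u ^ 2 * catS * binS + u) * fineS ^ 2 := by
  set K := treeS fun t => treeHillFree t * treeUUDD t with hK
  have h : K = u * ((u ^ 2 * catS * binS + u) * fineS + (catS - 1) * K) := by
    have h1 : treeS (fun t => treeUUDD t + if t = node () nil nil then 1 else 0) =
        u ^ 2 * catS * binS + u := by
      rw [treeS_add, treeS_treeUUDD, treeS_indicator]; simp [numNodes]
    rw [← h1, ← treeS_treeHillFree, ← treeS_ne_nil, hK, ← pairS_mul, ← pairS_mul, ← pairS_add]
    conv_lhs => rw [treeS_eq]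
    have h0 : treeUUDD nil = 0 := rfl
    simp only [h0, Nat.cast_zero, mul_zero, map_zero, zero_add]
    congr 2
    funext l r
    rw [treeUUDD_node, treeHillFree_node]
    by_cases hl : l = nil
    · subst hl; simp [h0]
    · by_cases hl' : l = node () nil nil <;> simp [hl, hl'] <;> ring
  have hb := fineS_mul
  linear_combination (-K) * hb + fineS * h

theorem X_mul_shiftS_neg_one : u * shiftS (-1) = treeS fun t => treeHillFree t * treeUUDD t := by
  rw [treeS_treeHillFree_mul_treeUUDD]
  have h2 : shiftS (-1) = _ := shiftS_neg 1
  rw [h2]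
  have := catS_eq
  have := binS_mul
  -- This is what remains of the claim after cancelling the common factor `u² · fineS`.
  have key : diagS * catS = (u * catS * binS + 1) * fineS := by
    apply mul_left_cancel₀ two_add_ne_zero
    have e1 : (2 + u) * (diagS * catS) = ((1 - u) * binS + 1) * catS := by
      linear_combination catS * diagS_mul
    have e2 : (2 + u) * ((u * catS * binS + 1) * fineS) =
        (u * catS * binS + 1) * (1 + catS) := by
      linear_combination (u * catS * binS + 1) * two_add_mul_fineS
    rw [e1, e2]
    grind
  linear_combination u ^ 2 * fineS * key

theorem X_mul_shiftS_two : u * shiftS 2 = treeS fun t => jumps t := by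
  rw [treeS_jumps]
  have h2 : shiftS 2 = _ := shiftS_succ 1
  rw [h2]
  have := catS_eq
  grind

/-! ### Low-order and high-order coefficients -/

theorem coeff_F_add_two (s n : ℕ) : (F (s + 2)).coeff (n + 3) =
    (F (s + 1)).coeff (n + 3) + (F (s + 1)).coeff (n + 2) + 2 * (F (s + 1)).coeff (n + 1)
      + (F s).coeff n := by
  have := intCoeff_F_add_two s (n + 3 : ℕ)
  rwa [show ((n + 3 : ℕ) : ℤ) - 1 = (n + 2 : ℕ) by push_cast; ring,
    show ((n + 3 : ℕ) : ℤ) - 2 = (n + 1 : ℕ) by push_cast; ring,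
    show ((n + 3 : ℕ) : ℤ) - 3 = (n : ℕ) by push_cast; ring, intCoeff_natCast, intCoeff_natCast,
    intCoeff_natCast, intCoeff_natCast, intCoeff_natCast] at this

theorem coeff_F_low (s : ℕ) : (F s).coeff 0 = 1 ∧ (F (s + 1)).coeff 1 = s ∧
    2 * (F (s + 1)).coeff 2 = s * (s + 3) ∧
    6 * (F (s + 2)).coeff 3 = s ^ 3 + 12 * s ^ 2 + 17 * s + 6 := by
  have i0 (s : ℕ) : (F (s + 2)).coeff 0 = (F (s + 1)).coeff 0 := by
    simpa [intCoeff] using intCoeff_F_add_two s 0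
  have i1 (s : ℕ) : (F (s + 2)).coeff 1 = (F (s + 1)).coeff 1 + (F (s + 1)).coeff 0 := by
    simpa [intCoeff] using intCoeff_F_add_two s 1
  have i2 (s : ℕ) : (F (s + 2)).coeff 2 =
      (F (s + 1)).coeff 2 + (F (s + 1)).coeff 1 + 2 * (F (s + 1)).coeff 0 := by
    simpa [intCoeff] using intCoeff_F_add_two s 2
  have i3 (s : ℕ) := coeff_F_add_two s 0
  have c0 (s : ℕ) : (F s).coeff 0 = 1 := by
    induction s using Nat.twoStepInduction with
    | zero => simp [F]
    | one => simp [F]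
    | more s _ ih => rw [i0, ih]
  have c1 (s : ℕ) : (F (s + 1)).coeff 1 = s := by
    induction s with
    | zero => simp [F, coeff_one]
    | succ s ih => rw [i1, ih, c0]; push_cast; ring
  have c2 (s : ℕ) : 2 * (F (s + 1)).coeff 2 = s * (s + 3) := by
    induction s with
    | zero => simp [F, coeff_one]
    | succ s ih => rw [i2, c0, c1]; push_cast; linear_combination ih
  refine ⟨c0 s, c1 s, c2 s, ?_⟩
  induction s with
  | zero =>
    have : (F 1).coeff 3 = 0 := by simp [F, coeff_one]
    have h1 := c1 0
    have h2 := c2 0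
    have h3 := i3 0
    simp only [zero_add] at h1 h2 h3
    rw [h3, this, h1, c0 0]
    push_cast at h2 ⊢
    linear_combination 3 * h2
  | succ s ih =>
    have h1 := c1 (s + 1)
    have h2 := c2 (s + 1)
    have h3 := i3 (s + 1)
    simp only [zero_add] at h3
    rw [h3, h1, c0]
    push_cast at h2 ⊢
    linear_combination 3 * h2 + ih

theorem A134465_succ (n : ℕ) :
    A134465 (n + 1) = 1 + 5 * n + 5 * n.choose 2 + n.choose 3 := by
  have h : A134465 (n + 1) = ∑ k ∈ range (4 + n), n.choose k * oneFiveFiveOne k := by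
    rw [A134465]
    refine sum_subset (range_subset_range.mpr (by omega)) fun k _ hk => ?_
    rw [Nat.add_sub_cancel, Nat.choose_eq_zero_of_lt (by simpa using hk), zero_mul]
  have h4 (k : ℕ) : oneFiveFiveOne (4 + k) = 0 := by rw [add_comm]; rfl
  rw [h, sum_range_add]
  simp only [h4, mul_zero, sum_const_zero, add_zero]
  simp [sum_range_succ, oneFiveFiveOne]
  ring

theorem two_mul_choose_two (n : ℕ) : (2 * n.choose 2 : ℤ) = n * (n - 1) := by
  induction n with
  | zero => simp
  | succ n ih =>
    rw [Nat.choose_succ_succ n 1, Nat.choose_one_right]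
    push_cast; linear_combination ih

theorem six_mul_choose_three (n : ℕ) : (6 * n.choose 3 : ℤ) = n * (n - 1) * (n - 2) := by
  induction n with
  | zero => simp
  | succ n ih =>
    rw [Nat.choose_succ_succ n 2]
    push_cast; linear_combination ih + 3 * two_mul_choose_two n

theorem coeff_F_three (s : ℕ) : (F (s + 2)).coeff 3 = A134465 (s + 1) := by
  rw [A134465_succ]
  apply mul_left_cancel₀ (by norm_num : (6 : ℤ) ≠ 0)
  push_cast
  linear_combination (coeff_F_low s).2.2.2 - 15 * two_mul_choose_two s - six_mul_choose_three s

/-- The binomial transform of an integer sequence. -/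
def binomialTransform (f : ℕ → ℤ) (n : ℕ) : ℤ := ∑ k ∈ range (n + 1), n.choose k * f k

theorem binomialTransform_succ (f : ℕ → ℤ) (n : ℕ) : binomialTransform f (n + 1) =
    binomialTransform f n + binomialTransform (fun k => f (k + 1)) n := by
  have h : binomialTransform f n = ∑ k ∈ range (n + 2), n.choose k * f k := by
    rw [binomialTransform, sum_range_succ _ (n + 1), Nat.choose_succ_self]; simp
  rw [h, binomialTransform, binomialTransform, sum_range_succ', sum_range_succ' _ (n + 1)]
  simp only [Nat.choose_succ_succ, Nat.cast_add, add_mul, sum_add_distrib, Nat.choose_zero_right]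
  ring

/-- The transform of `(-1)^k` times a linear function is a second or higher difference, so it
vanishes from index `2` on. -/
theorem binomialTransform_alternating_linear (n : ℕ) (a b a' b' : ℤ) :
    binomialTransform (fun k => a + b * k + (-1) ^ k * (a' + b' * k)) (n + 2) =
      (4 * a + (2 * n + 4) * b) * 2 ^ n := by
  induction n generalizing a b a' b' with
  | zero =>
    simp [binomialTransform, sum_range_succ]
    ring
  | succ n ih =>
    have h : (fun k : ℕ => a + b * ((k + 1 : ℕ) : ℤ) +
        (-1) ^ (k + 1) * (a' + b' * ((k + 1 : ℕ) : ℤ)))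
        = fun k : ℕ => (a + b) + b * (k : ℤ) + (-1) ^ k * (-(a' + b') + (-b') * (k : ℤ)) := by
      funext k; push_cast; ring
    rw [binomialTransform_succ, ih, h, ih]
    push_cast
    ring

theorem four_mul_interleaved (k : ℕ) :
    4 * (interleaved k : ℤ) = 2 + 3 * k + (-1) ^ k * (2 + (-1) * k) := by
  unfold interleaved
  split_ifs with h
  · rw [h.neg_one_pow]
    obtain ⟨m, rfl⟩ := h
    rw [show (m + m) / 2 = m by omega]
    push_cast; ring
  · rw [(Nat.not_even_iff_odd.mp h).neg_one_pow]
    obtain ⟨m, rfl⟩ := Nat.not_even_iff_odd.mp h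
    rw [show (2 * m + 1) / 2 = m by omega]
    push_cast; ring

theorem A098156_add_two (n : ℕ) : 2 * (A098156 (n + 2) : ℤ) = (3 * n + 10) * 2 ^ n := by
  have h : 4 * (A098156 (n + 2) : ℤ) =
      binomialTransform (fun k => 2 + 3 * k + (-1) ^ k * (2 + (-1) * k)) (n + 2) := by
    rw [A098156, binomialTransform]
    push_cast
    rw [mul_sum]
    refine sum_congr rfl fun k _ => ?_
    rw [← four_mul_interleaved]; ring
  rw [binomialTransform_alternating_linear] at h
  linarith

/-- The degree of `F s` is at most `2s - 1` for `s ≥ 1`; `hm` excludes the constant term of `F 0`.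
-/
theorem coeff_F_eq_zero {s m : ℕ} (h : 2 * s ≤ m) (hm : 1 ≤ m) : (F s).coeff m = 0 := by
  induction s using Nat.twoStepInduction generalizing m with
  | zero => rw [F, coeff_one, if_neg (by omega)]
  | one => rw [F, coeff_one, if_neg (by omega)]
  | more s ih0 ih1 =>
    obtain ⟨n, rfl⟩ : ∃ n, m = n + 3 := ⟨m - 3, by omega⟩
    rw [coeff_F_add_two, ih0 (by omega) (by omega), ih1 (by omega) (by omega),
      ih1 (by omega) (by omega), ih1 (by omega) (by omega)]
    norm_num

theorem coeff_F_leading (s : ℕ) : (F (s + 2)).coeff (2 * s + 3) = 2 ^ s := by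
  induction s with
  | zero =>
    rw [coeff_F_add_two]
    simp [F, coeff_one]
  | succ s ih =>
    rw [show 2 * (s + 1) + 3 = 2 * s + 2 + 3 by ring, coeff_F_add_two,
      coeff_F_eq_zero (s := s + 1 + 1) (m := 2 * s + 2 + 3) (by omega) (by omega),
      coeff_F_eq_zero (s := s + 1 + 1) (m := 2 * s + 2 + 2) (by omega) (by omega),
      coeff_F_eq_zero (s := s + 1) (by omega) (by omega), show 2 * s + 2 + 1 = 2 * s + 3 by ring,
      ih]
    ring

/-- The subleading coefficient `x_s` satisfies `x_{s+1} = 2 x_s + 2^{s+1} + 2^s`, the last two terms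
being leading coefficients. -/
theorem two_mul_coeff_F_subleading (s : ℕ) :
    2 * (F (s + 3)).coeff (2 * s + 4) = (3 * s + 10) * 2 ^ s := by
  induction s with
  | zero =>
    have h1 : (F 1).coeff 1 = 0 := by simp [F, coeff_one]
    have h2 := (coeff_F_low 1).2.2.1
    have h3 := coeff_F_leading 0
    have h := coeff_F_add_two 1 1
    rw [coeff_F_eq_zero (s := 1 + 1) (m := 1 + 3) (by omega) (by omega), h1] at h
    norm_num at h h2 h3 ⊢
    rw [h]
    linarith
  | succ s ih =>
    have h := coeff_F_add_two (s + 2) (2 * s + 3)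
    have h1 := coeff_F_leading (s + 1)
    rw [show 2 * (s + 1) + 3 = 2 * s + 3 + 2 by ring] at h1
    rw [coeff_F_eq_zero (s := s + 2 + 1) (m := 2 * s + 3 + 3) (by omega) (by omega),
      coeff_F_leading s,
      show s + 2 + 1 = s + 1 + 2 by ring, h1] at h
    rw [show s + 1 + 3 = s + 2 + 2 by ring, show 2 * (s + 1) + 4 = 2 * s + 3 + 3 by ring, h]
    push_cast
    linear_combination 2 * ih

theorem coeff_F_subleading (s : ℕ) : (F (s + 2)).coeff (2 * s + 2) = A098156 (s + 1) := by
  cases s with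
  | zero =>
    have h2 := (coeff_F_low 1).2.2.1
    have h : A098156 (0 + 1) = 2 := by decide
    rw [h]
    norm_num at h2 ⊢
    linarith
  | succ s =>
    have h1 := two_mul_coeff_F_subleading s
    have h2 := A098156_add_two s
    have h3 : (F (s + 1 + 2)).coeff (2 * (s + 1) + 2) = (F (s + 3)).coeff (2 * s + 4) := rfl
    rw [h3, show s + 1 + 1 = s + 2 from rfl]
    linarith

end OEIS

open OEIS in
theorem theorem5 (s : ℕ) (hs : 2 ≤ s) :
    (F s).coeff 3 = (OEIS.A134465 (s - 1) : ℤ) ∧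
    (F s).coeff (2 * s - 2) = (OEIS.A098156 (s - 1) : ℤ) ∧
    (F s).coeff (s - 1) = (OEIS.A116914 (s + 1) : ℤ) ∧
    (F s).coeff s = (OEIS.A072547 (s + 1) : ℤ) ∧
    (F s).coeff (s + 1) = (OEIS.A002054 (s - 1) : ℤ) ∧
    (F s).coeff (s + 2) = (OEIS.A127531 s : ℤ) := by
  obtain ⟨n, rfl⟩ : ∃ n, s = n + 2 := ⟨s - 2, by omega⟩
  have diag (k : ℤ) (m : ℕ) (hm : (m : ℤ) = (n + 2 : ℕ) + k) :
      ((F (n + 2)).coeff m : ℚ) = PowerSeries.coeff (n + 2) (shiftS k) := by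
    rw [← intCoeff_F_eq_coeff_shiftS, ← hm, intCoeff_natCast]
  refine ⟨coeff_F_three n, coeff_F_subleading n, ?_, ?_, ?_, ?_⟩
  -- The tree series is indexed by semilength `s + 1`, whence the extra factor `u`.
  · rw [← Int.cast_inj (α := ℚ), diag (-1) _ (by push_cast; ring), Int.cast_natCast, A116914_eq,
      ← X_mul_shiftS_neg_one, PowerSeries.coeff_succ_X_mul]
  · rw [← Int.cast_inj (α := ℚ), diag 0 _ (by simp), Int.cast_natCast, shiftS_zero, A072547,
      Nat.add_sub_cancel, alternatingArray_eq_coeff]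
  -- Since `S_1 = u² B C³`, its coefficient at `n + 2` is `(2n + 3).choose n`.
  · have h1 : shiftS 1 = _ := shiftS_succ 0
    rw [← Int.cast_inj (α := ℚ), diag 1 _ (by push_cast; ring), Int.cast_natCast, h1, pow_zero,
      mul_one, mul_assoc, PowerSeries.coeff_X_pow_mul, ← choose_two_mul_add]
    rfl
  · rw [← Int.cast_inj (α := ℚ), diag 2 _ (by push_cast; ring), Int.cast_natCast,
      ← PowerSeries.coeff_succ_X_mul, X_mul_shiftS_two, treeS, PowerSeries.coeff_mk, A127531]
    push_cast
    rfl
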